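/- For permutations $q\in S_k$ and $p\in S_n$ in one-line notation, an occurrence of the pattern $q$ in $p$ is a choice of indices $i_1<\dots<i_k$ such that $p_{i_1}\cdots p_{i_k}$ is in the same relative order as $q_1\cdots q_k$; $p$ avoids $q$ if there is no such occurrence. Let $\mathrm{Av}_n(123)$ be the set of permutations in $S_n$ that avoid $123$, and let $d_n=f_{321}(\mathrm{Av}_n(123))$ be the total number of occurrences of the pattern $321$ in all permutations of $\mathrm{Av}_n(123)$. Then, as formal power series over $\mathbb{Q}$, $$\sum_{n\ge 0} d_n x^n=\frac{1}{2x}\left(\frac{8x^3-20x^2+8x-1}{(1-4x)^2}-\frac{36x^3-34x^2+10x-1}{(1-4x)^{5/2}}\right),$$ where $(1-4x)^{5/2}=\left(\sqrt{1-4x}\right)^5$ and $\sqrt{1-4x}$ is the square root of $1-4x$ with constant term $1$. Here division by $2x$ means that the series in parentheses equals $2x\sum_{n\ge 0} d_n x^n$. -/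

import Mathlib

/-- Increasing positions `f 0 < f 1 < ⋯` of `p` at which the entries of `p` are in the same
relative order as the entries of `q`. -/
def IsOccurrence {k n : ℕ} (q : Equiv.Perm (Fin k)) (p : Equiv.Perm (Fin n))
    (f : Fin k → Fin n) : Prop :=
  (∀ i j, i < j → f i < f j) ∧ ∀ i j, q i < q j ↔ p (f i) < p (f j)

instance {k n : ℕ} (q : Equiv.Perm (Fin k)) (p : Equiv.Perm (Fin n)) :
    DecidablePred (IsOccurrence q p) := fun f => by
  unfold IsOccurrence; infer_instance

/-- The number of occurrences of the pattern `q` in the permutation `p`. -/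
def patternCount {k n : ℕ} (q : Equiv.Perm (Fin k)) (p : Equiv.Perm (Fin n)) : ℕ :=
  (Finset.univ.filter (fun f : Fin k → Fin n => IsOccurrence q p f)).card

/-- `p` contains `q` as a pattern. -/
def ContainsPattern {k n : ℕ} (q : Equiv.Perm (Fin k)) (p : Equiv.Perm (Fin n)) : Prop :=
  ∃ f : Fin k → Fin n, IsOccurrence q p f

instance {k n : ℕ} (q : Equiv.Perm (Fin k)) :
    DecidablePred (fun p : Equiv.Perm (Fin n) => ContainsPattern q p) := fun p => by
  unfold ContainsPattern; infer_instance

/-- The set of permutations of length `n` that avoid `q`. -/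
def avoiders {k : ℕ} (n : ℕ) (q : Equiv.Perm (Fin k)) : Finset (Equiv.Perm (Fin n)) :=
  Finset.univ.filter (fun p => ¬ ContainsPattern q p)

/-- The total number of occurrences of `q` in the permutations of the set `C`. -/
def totalPatternCount {k n : ℕ} (q : Equiv.Perm (Fin k)) (C : Finset (Equiv.Perm (Fin n))) : ℕ :=
  ∑ p ∈ C, patternCount q p

/-- The permutation `123` in one-line notation. -/
def perm123 : Equiv.Perm (Fin 3) := Equiv.refl (Fin 3)

/-- The permutation `321` in one-line notation. -/
def perm321 : Equiv.Perm (Fin 3) := Fin.revPerm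

/-- The formal power series `√(1 - 4x)` over `ℚ`, that is, the binomial series `(1 + y)^(1/2)`
at `y = -4x`. -/
noncomputable def sqrtOneSubFourX : PowerSeries ℚ :=
  PowerSeries.rescale (-4 : ℚ) (PowerSeries.binomialSeries ℚ (1 / 2 : ℚ))

/-- `√(1 - 4x)` is indeed a square root of `1 - 4x`. -/
theorem sqrtOneSubFourX_sq :
    sqrtOneSubFourX ^ 2 = 1 - 4 * (PowerSeries.X : PowerSeries ℚ) := by
  have h : (PowerSeries.binomialSeries ℚ (1 / 2 : ℚ)) ^ 2 = 1 + PowerSeries.X := by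
    rw [sq, ← PowerSeries.binomialSeries_add]
    have := PowerSeries.binomialSeries_nat (R := ℚ) (A := ℚ) 1
    norm_num at this ⊢
    exact this
  have h4 : (PowerSeries.C (-4 : ℚ)) = -(4 : PowerSeries ℚ) := by
    rw [map_neg]; rfl
  rw [sqrtOneSubFourX, ← map_pow, h, map_add, map_one, PowerSeries.rescale_X, h4]
  ring

/-- `√(1 - 4x)` is the square root whose constant term is `1`. -/
theorem constantCoeff_sqrtOneSubFourX : PowerSeries.constantCoeff sqrtOneSubFourX = 1 := by
  rw [sqrtOneSubFourX, ← PowerSeries.coeff_zero_eq_constantCoeff_apply, PowerSeries.coeff_rescale]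
  simp

/-!
Fix a `123`-avoider `p` of length `n` and let `l` and `r` count the smaller entries to the left and
the larger entries to the right of the position `j`. The number of occurrences of `321` with middle
position `j` is `(j - l) * (p j - l)`. Avoidance of `123` means `l * r = 0` for all `j`, while
always `l - r = p j + j - (n - 1)`; so the count depends only on `∑ r`, `∑ l`, `∑ r ^ 2` and
`∑ l ^ 2`, and reverse-complement exchanges `l` and `r` over the whole class.

Deleting the first entry organises the `123`-avoiders into the Catalan generating tree, in which a
node with label `k` has children with labels `k + 1, 1, …, k`. A new first entry with `r` larger
entries after it adds `r` to the first total and `r ^ 2` to the second, and the totals below a node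
are `X * c ^ (k + 1)` times a polynomial in `k`, `c` being the Catalan series. The factors `n` in
the count are supplied by the Euler operator `X * d/dX`, which preserves Laurent polynomials in
`√(1 - 4 * X)`.
-/

open Finset PowerSeries
open Equiv (Perm)

section Occurrences

variable {k n : ℕ} {p : Perm (Fin n)}

theorem isOccurrence_refl_iff {f : Fin k → Fin n} :
    IsOccurrence (Equiv.refl (Fin k)) p f ↔ StrictMono f ∧ StrictMono (p ∘ f) :=
  ⟨fun h => ⟨fun i j => h.1 i j, fun i j => (h.2 i j).1⟩,
    fun h => ⟨fun _ _ hij => h.1 hij, fun _ _ => h.2.lt_iff_lt.symm⟩⟩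

theorem isOccurrence_revPerm_iff {f : Fin k → Fin n} :
    IsOccurrence Fin.revPerm p f ↔ StrictMono f ∧ StrictAnti (p ∘ f) := by
  simp only [IsOccurrence, Fin.revPerm_apply, Fin.rev_lt_rev]
  exact ⟨fun h => ⟨fun i j => h.1 i j, fun i j => (h.2 j i).1⟩,
    fun h => ⟨fun _ _ hij => h.1 hij, fun _ _ => h.2.lt_iff_gt.symm⟩⟩

theorem isOccurrence_perm123_iff {f : Fin 3 → Fin n} :
    IsOccurrence perm123 p f ↔
      (f 0 < f 1 ∧ f 1 < f 2) ∧ p (f 0) < p (f 1) ∧ p (f 1) < p (f 2) := by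
  simp only [perm123, isOccurrence_refl_iff, Fin.strictMono_iff_lt_succ, Fin.forall_fin_two]
  rfl

theorem isOccurrence_perm321_iff {f : Fin 3 → Fin n} :
    IsOccurrence perm321 p f ↔
      (f 0 < f 1 ∧ f 1 < f 2) ∧ p (f 1) < p (f 0) ∧ p (f 2) < p (f 1) := by
  simp only [perm321, isOccurrence_revPerm_iff, Fin.strictMono_iff_lt_succ,
    Fin.strictAnti_iff_succ_lt, Fin.forall_fin_two]
  rfl

/-- `p` has no increasing subsequence of length three: avoidance of `123` without reference to
occurrence maps `Fin 3 → Fin n`. -/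
def Avoids123 (p : Perm (Fin n)) : Prop :=
  ∀ ⦃i j k⦄, i < j → j < k → p i < p j → ¬ p j < p k

theorem mem_avoiders_perm123 : p ∈ avoiders n perm123 ↔ Avoids123 p := by
  simp only [avoiders, ContainsPattern, isOccurrence_perm123_iff, mem_filter_univ]
  exact ⟨fun h i j k hij hjk hpij hpjk => h ⟨![i, j, k], ⟨hij, hjk⟩, hpij, hpjk⟩,
    fun h ⟨_, ⟨h01, h12⟩, hp01, hp12⟩ => h h01 h12 hp01 hp12⟩

theorem patternCount_perm321_eq_sum :
    patternCount perm321 p = ∑ j, #{i | i < j ∧ p j < p i} * #{k | j < k ∧ p k < p j} := by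
  simp_rw [patternCount, isOccurrence_perm321_iff, ← card_product, ← card_sigma]
  refine card_nbij' (fun f => ⟨f 1, f 0, f 2⟩) (fun x => ![x.2.1, x.1, x.2.2]) ?_ ?_ ?_ ?_
  · intro f
    simp only [coe_filter, mem_univ, true_and, Set.mem_ofPred_eq, coe_sigma, coe_univ,
      coe_product, Set.mem_sigma_iff, Set.mem_univ, Set.mem_prod, and_imp]
    tauto
  · rintro ⟨j, i, k⟩
    simp only [coe_filter, mem_univ, true_and, Set.mem_ofPred_eq, coe_sigma, coe_univ,
      coe_product, Set.mem_sigma_iff, Set.mem_univ, Set.mem_prod, Matrix.cons_val, and_imp]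
    tauto
  · intro f _
    exact FinVec.etaExpand_eq f
  · exact fun _ _ => rfl

end Occurrences

section CountingByMiddleEntry

variable {n : ℕ} (p : Perm (Fin n)) (j : Fin n)

/-- The number of non-inversions of `p` whose larger entry is at position `j`. -/
def leftSmaller : ℕ := #{i | i < j ∧ p i < p j}

/-- The number of non-inversions of `p` whose smaller entry is at position `j`. -/
def rightLarger : ℕ := #{k | j < k ∧ p j < p k}

theorem card_filter_add_card_filter_of_disjoint {α : Type*} [Fintype α] {P Q R : α → Prop}
    [DecidablePred P] [DecidablePred Q] [DecidablePred R] (hdisj : ∀ a, P a → ¬ Q a)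
    (hor : ∀ a, P a ∨ Q a ↔ R a) : #{a | P a} + #{a | Q a} = #{a | R a} := by
  classical
  rw [← card_union_of_disjoint (disjoint_filter.2 fun a _ => hdisj a), ← filter_or]
  simp only [hor]

theorem card_leftLarger_add_leftSmaller : #{i | i < j ∧ p j < p i} + leftSmaller p j = j := by
  rw [leftSmaller, card_filter_add_card_filter_of_disjoint (R := (· < j)), filter_gt_eq_Iio,
    Fin.card_Iio]
  · exact fun i h h' => h.2.not_gt h'.2
  · intro i
    rw [← and_or_left, ← ne_iff_gt_or_lt, p.injective.ne_iff]
    exact and_iff_left_of_imp LT.lt.ne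

theorem card_rightSmaller_add_leftSmaller :
    #{k | j < k ∧ p k < p j} + leftSmaller p j = p j := by
  rw [leftSmaller, card_filter_add_card_filter_of_disjoint (R := (p · < p j)),
    card_equiv p (t := Iio (p j)) (by simp), Fin.card_Iio]
  · exact fun k h h' => h.1.not_gt h'.1
  · intro k
    rw [← or_and_right, ← ne_iff_gt_or_lt, ← p.injective.ne_iff]
    exact and_iff_right_of_imp LT.lt.ne

theorem card_rightSmaller_add_rightLarger :
    #{k | j < k ∧ p k < p j} + rightLarger p j + j + 1 = n := by
  rw [rightLarger, card_filter_add_card_filter_of_disjoint (R := (j < ·)), filter_lt_eq_Ioi,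
    Fin.card_Ioi]
  · omega
  · exact fun k h h' => h.2.not_gt h'.2
  · intro k
    rw [← and_or_left, ← ne_iff_lt_or_gt, p.injective.ne_iff]
    exact and_iff_left_of_imp LT.lt.ne'

theorem rightLarger_add_apply : rightLarger p j + p j + j + 1 = n + leftSmaller p j := by
  have := card_rightSmaller_add_leftSmaller p j
  have := card_rightSmaller_add_rightLarger p j
  omega

variable {p}

theorem Avoids123.leftSmaller_mul_rightLarger (hp : Avoids123 p) :
    leftSmaller p j * rightLarger p j = 0 := by
  rw [leftSmaller, rightLarger, mul_eq_zero, card_filter_eq_zero_iff, card_filter_eq_zero_iff]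
  by_contra! ⟨⟨i, _, hij, hpij⟩, k, _, hjk, hpjk⟩
  exact hp hij hjk hpij hpjk

theorem Avoids123.patternCount_perm321 (hp : Avoids123 p) :
    (patternCount perm321 p : ℚ) =
      ∑ j : Fin n, (j : ℚ) * p j - (n - 1) * ∑ j, (leftSmaller p j : ℚ) := by
  rw [patternCount_perm321_eq_sum, mul_sum, ← sum_sub_distrib, Nat.cast_sum]
  refine sum_congr rfl fun j _ => ?_
  have hl : (#{i | i < j ∧ p j < p i} + leftSmaller p j : ℚ) = j := by
    exact_mod_cast card_leftLarger_add_leftSmaller p j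
  have hs : (#{k | j < k ∧ p k < p j} + leftSmaller p j : ℚ) = p j := by
    exact_mod_cast card_rightSmaller_add_leftSmaller p j
  have hr : (rightLarger p j + p j + j + 1 : ℚ) = n + leftSmaller p j := by
    exact_mod_cast rightLarger_add_apply p j
  have h0 : (leftSmaller p j * rightLarger p j : ℚ) = 0 := by
    exact_mod_cast hp.leftSmaller_mul_rightLarger j
  rw [Nat.cast_mul, eq_sub_of_add_eq hl, eq_sub_of_add_eq hs]
  linear_combination -(leftSmaller p j : ℚ) * hr + h0

theorem sum_fin_val (R : Type*) [CommRing R] (n : ℕ) :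
    2 * ∑ j : Fin n, (j : R) = n * (n - 1) := by
  induction n with
  | zero => simp
  | succ n ih =>
    simp only [Fin.sum_univ_castSucc, Fin.val_castSucc, Fin.val_last]
    push_cast
    linear_combination ih

theorem sum_fin_val_sq (R : Type*) [CommRing R] (n : ℕ) :
    6 * ∑ j : Fin n, (j : R) ^ 2 = n * (n - 1) * (2 * n - 1) := by
  induction n with
  | zero => simp
  | succ n ih =>
    simp only [Fin.sum_univ_castSucc, Fin.val_castSucc, Fin.val_last]
    push_cast
    linear_combination ih

theorem Avoids123.sum_mul_apply (hp : Avoids123 p) :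
    6 * ∑ j : Fin n, (j : ℚ) * p j = n * (n - 1) * (n - 2) +
      3 * (∑ j, (leftSmaller p j : ℚ) ^ 2 + ∑ j, (rightLarger p j : ℚ) ^ 2) := by
  -- Since `l * r = 0`, squaring `l - r = p j + j - (n - 1)` expresses `j * p j` by squares.
  have hj (j : Fin n) : 2 * ((j : ℚ) * p j) = leftSmaller p j ^ 2 + rightLarger p j ^ 2
      + 2 * (n - 1) * (j + p j) - j ^ 2 - p j ^ 2 - (n - 1) ^ 2 := by
    have hr : (rightLarger p j + p j + j + 1 : ℚ) = n + leftSmaller p j := by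
      exact_mod_cast rightLarger_add_apply p j
    have h0 : (leftSmaller p j * rightLarger p j : ℚ) = 0 := by
      exact_mod_cast hp.leftSmaller_mul_rightLarger j
    linear_combination (leftSmaller p j - rightLarger p j + (j + p j - (n - 1)) : ℚ) * hr - 2 * h0
  have hsum := sum_congr rfl fun j (_ : j ∈ univ) => hj j
  simp only [← mul_sum, sum_add_distrib, sum_sub_distrib,
    Equiv.sum_comp p fun j : Fin n => (j : ℚ), Equiv.sum_comp p fun j : Fin n => (j : ℚ) ^ 2,
    sum_const, card_univ, Fintype.card_fin, nsmul_eq_mul] at hsum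
  linear_combination 3 * hsum + 6 * (n - 1) * sum_fin_val ℚ n - sum_fin_val_sq ℚ n

end CountingByMiddleEntry

section ReverseComplement

variable {n : ℕ} {p : Perm (Fin n)}

theorem Avoids123.permCongr_revPerm (hp : Avoids123 p) : Avoids123 (Fin.revPerm.permCongr p) := by
  intro i j k hij hjk hpij hpjk
  simp only [Equiv.permCongr_apply, Fin.revPerm_symm, Fin.revPerm_apply, Fin.rev_lt_rev]
    at hpij hpjk
  exact hp (Fin.rev_lt_rev.2 hjk) (Fin.rev_lt_rev.2 hij) hpjk hpij

theorem rightLarger_permCongr_revPerm (j : Fin n) :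
    rightLarger (Fin.revPerm.permCongr p) j.rev = leftSmaller p j :=
  card_equiv Fin.revPerm (by simp [Fin.rev_lt_iff])

theorem sum_avoiders_leftSmaller {M : Type*} [AddCommMonoid M] (g : ℕ → M) (n : ℕ) :
    ∑ p ∈ avoiders n perm123, ∑ j, g (leftSmaller p j) =
      ∑ p ∈ avoiders n perm123, ∑ j, g (rightLarger p j) := by
  have hinv (p : Perm (Fin n)) : Fin.revPerm.permCongr (Fin.revPerm.permCongr p) = p := by
    ext; simp
  have hmem (p) (hp : p ∈ avoiders n perm123) :
      Fin.revPerm.permCongr p ∈ avoiders n perm123 :=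
    mem_avoiders_perm123.2 (mem_avoiders_perm123.1 hp).permCongr_revPerm
  refine sum_nbij' (Fin.revPerm.permCongr ·) (Fin.revPerm.permCongr ·) hmem hmem
    (fun p _ => hinv p) (fun p _ => hinv p) fun p _ => ?_
  rw [← Equiv.sum_comp Fin.revPerm fun j => g (rightLarger _ j)]
  simp only [Fin.revPerm_apply, rightLarger_permCongr_revPerm]

end ReverseComplement

section PrependEntry

variable {n : ℕ} (r : Fin (n + 1)) (p : Perm (Fin n))

/-- The permutation whose first entry has exactly `r` larger entries after it, and whose other
entries are in the relative order of `p`. -/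
def prependEntry : Perm (Fin (n + 1)) :=
  ((finSuccEquiv' 0).trans p.optionCongr).trans (finSuccEquiv' r.rev).symm

@[simp]
theorem prependEntry_zero : prependEntry r p 0 = r.rev := by
  simp [prependEntry]

@[simp]
theorem prependEntry_succ (i : Fin n) : prependEntry r p i.succ = r.rev.succAbove (p i) := by
  have hi : finSuccEquiv' (0 : Fin (n + 1)) i.succ = some i := by
    rw [← Fin.succAbove_zero, finSuccEquiv'_succAbove]
  simp [prependEntry, hi]

theorem prependEntry_bijective (n : ℕ) :
    Function.Bijective fun x : Fin (n + 1) × Perm (Fin n) => prependEntry x.1 x.2 := by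
  refine (Fintype.bijective_iff_injective_and_card _).2 ⟨?_, ?_⟩
  · rintro ⟨r, p⟩ ⟨r', p'⟩ h
    obtain rfl : r = r' := by simpa using DFunLike.congr_fun h 0
    have hp : p = p' := Equiv.ext fun i => by simpa using DFunLike.congr_fun h i.succ
    rw [hp]
  · simp [Fintype.card_perm, Nat.factorial_succ]

theorem rightLarger_prependEntry_succ (i : Fin n) :
    rightLarger (prependEntry r p) i.succ = rightLarger p i := by
  simp [rightLarger, Fin.card_filter_univ_succ]

theorem rightLarger_prependEntry_zero : rightLarger (prependEntry r p) 0 = r := by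
  have h := rightLarger_add_apply (prependEntry r p) 0
  have hl : leftSmaller (prependEntry r p) 0 = 0 := by simp [leftSmaller]
  rw [hl, prependEntry_zero, Fin.val_rev, Fin.val_zero] at h
  omega

/-- The label of `p` in the generating tree of the `123`-avoiders: the largest `r` such that the
smaller entry of every non-inversion of `p` has value (counted from `0`) less than `n - r`. It is
the greatest `r` for which `prependEntry r p` still avoids `123`. -/
def insertionLabel : ℕ :=
  n - ({x | x.1 < x.2 ∧ p x.1 < p x.2} : Finset (Fin n × Fin n)).sup fun x => (p x.1 : ℕ) + 1

variable {p}

theorem le_insertionLabel_iff {m : ℕ} :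
    m ≤ insertionLabel p ↔ m ≤ n ∧ ∀ i j, i < j → p i < p j → (p i : ℕ) + m < n := by
  have hsup : ({x | x.1 < x.2 ∧ p x.1 < p x.2} : Finset (Fin n × Fin n)).sup
      (fun x => (p x.1 : ℕ) + 1) ≤ n := Finset.sup_le fun x _ => (p x.1).2
  have hsplit {a b : ℕ} : a + b ≤ n ↔ a ≤ n ∧ b ≤ n - a := by omega
  rw [insertionLabel, Nat.le_sub_iff_add_le hsup, hsplit, Finset.sup_le_iff]
  refine and_congr_right fun hm => ?_
  simp only [mem_filter_univ, Prod.forall, and_imp, Nat.le_sub_iff_add_le hm, Nat.lt_iff_add_one_le,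
    Nat.add_right_comm _ 1 m]

variable {r}

theorem rev_lt_succAbove_rev_iff {x : Fin n} : r.rev < r.rev.succAbove x ↔ n ≤ x + r := by
  rw [Fin.lt_succAbove_iff_le_castSucc, Fin.le_def, Fin.val_castSucc, Fin.val_rev]
  omega

theorem avoids123_prependEntry_iff :
    Avoids123 (prependEntry r p) ↔ Avoids123 p ∧ r ≤ insertionLabel p := by
  rw [le_insertionLabel_iff, and_iff_right (Fin.is_le r), and_comm]
  simp only [Avoids123, Fin.forall_fin_succ, prependEntry_zero, prependEntry_succ,
    rev_lt_succAbove_rev_iff, Fin.succAbove_lt_succAbove_iff, Fin.succ_lt_succ_iff,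
    Fin.not_lt_zero, Fin.succ_pos, ← not_lt (a := (_ : ℕ)), not_imp_not, true_and,
    false_imp_iff, true_imp_iff, implies_true]

theorem insertionLabel_prependEntry_zero :
    insertionLabel (prependEntry 0 p) = insertionLabel p + 1 := by
  refine eq_of_forall_le_iff fun m => ?_
  cases m with
  | zero => simp
  | succ m =>
    rw [Nat.succ_le_succ_iff, le_insertionLabel_iff, le_insertionLabel_iff]
    simp [Fin.forall_fin_succ, ← add_assoc, Fin.le_last]

theorem insertionLabel_prependEntry (h0 : r ≠ 0) (hr : r ≤ insertionLabel p) :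
    insertionLabel (prependEntry r p) = r := by
  have hpos : 0 < (r : ℕ) := Nat.pos_of_ne_zero (Fin.val_ne_zero_iff.2 h0)
  obtain ⟨hrn, hp⟩ := le_insertionLabel_iff.1 hr
  refine eq_of_forall_le_iff fun m => ?_
  rw [le_insertionLabel_iff]
  constructor
  · rintro ⟨-, h⟩
    have := h 0 (p.symm ⟨n - r, by omega⟩).succ (Fin.succ_pos _)
      (by simp [rev_lt_succAbove_rev_iff, hrn])
    rw [prependEntry_zero, Fin.val_rev] at this
    omega
  · intro hm
    refine ⟨by omega, fun i j hij => ?_⟩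
    obtain ⟨j, rfl⟩ := Fin.exists_succ_eq.2 (Fin.ne_zero_of_lt hij)
    cases i using Fin.cases with
    | zero => rw [prependEntry_zero, Fin.val_rev]; omega
    | succ i =>
      intro hpij
      simp only [prependEntry_succ, Fin.succAbove_lt_succAbove_iff, Fin.succ_lt_succ_iff]
        at hij hpij
      have := hp i j hij hpij
      rw [prependEntry_succ, Fin.succAbove_of_castSucc_lt _ _ (by simp [Fin.lt_def]; omega),
        Fin.val_castSucc]
      omega

end PrependEntry

section GeneratingTree

variable {n : ℕ}

theorem insertionLabel_le (p : Perm (Fin n)) : insertionLabel p ≤ n :=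
  Nat.sub_le _ _

theorem sum_avoiders_succ {M : Type*} [AddCommMonoid M] (F : Perm (Fin (n + 1)) → M) :
    ∑ q ∈ avoiders (n + 1) perm123, F q =
      ∑ p ∈ avoiders n perm123, ∑ r : Fin (insertionLabel p + 1),
        F (prependEntry (r.castLE (Nat.succ_le_succ (insertionLabel_le p))) p) := by
  rw [sum_sigma']
  symm
  refine sum_nbij (fun x => prependEntry (x.2.castLE _) x.1) ?_ ?_ ?_ fun _ _ => rfl
  · rintro ⟨p, r⟩ h
    rw [mem_avoiders_perm123, avoids123_prependEntry_iff]
    exact ⟨mem_avoiders_perm123.1 (mem_sigma.1 h).1, Nat.le_of_lt_succ r.2⟩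
  · rintro ⟨p, r⟩ - ⟨p', r'⟩ - h
    obtain ⟨hr, rfl⟩ := Prod.mk.inj ((prependEntry_bijective n).injective (a₁ := (_, p)) h)
    obtain rfl : r = r' := Fin.castLE_injective (Nat.succ_le_succ (insertionLabel_le p)) hr
    rfl
  · intro q hq
    obtain ⟨⟨r, p⟩, rfl⟩ := (prependEntry_bijective n).surjective q
    obtain ⟨hp, hr⟩ := avoids123_prependEntry_iff.1 (mem_avoiders_perm123.1 hq)
    exact ⟨⟨p, r, Nat.lt_succ_of_le hr⟩, by simp [mem_avoiders_perm123, hp], rfl⟩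

theorem sum_avoiders_eq_of_recurrence {S M : Type*} [AddCommMonoid S] [AddCommMonoid M]
    {g : ℕ → S} (hg : g 0 = 0) {Φ : ℕ → ℕ → S → M}
    (hΦ : ∀ m k s, Φ (m + 1) k s = Φ m (k + 1) s + ∑ r ∈ range k, Φ m (r + 1) (g (r + 1) + s))
    (m n : ℕ) :
    ∑ p ∈ avoiders n perm123, Φ m (insertionLabel p) (∑ i, g (rightLarger p i)) =
      Φ (n + m) 0 0 := by
  induction n generalizing m with
  | zero =>
    have hav : avoiders 0 perm123 = {1} := by decide
    simp [hav, insertionLabel]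
  | succ n ih =>
    rw [sum_avoiders_succ, Nat.add_right_comm, add_assoc, ← ih]
    refine sum_congr rfl fun p _ => ?_
    simp only [Fin.sum_univ_succ, rightLarger_prependEntry_zero, rightLarger_prependEntry_succ]
    rw [hΦ, ← Fin.sum_univ_eq_sum_range (fun r => Φ m (r + 1) _)]
    congr 1
    · simp [insertionLabel_prependEntry_zero, hg]
    · refine sum_congr rfl fun r _ => ?_
      rw [insertionLabel_prependEntry (Fin.ne_of_gt (Nat.succ_pos _))]
      · rfl
      · simp

end GeneratingTree

section CatalanSeries

theorem pow_succ_eq_one_add_mul_sum {R : Type*} [CommSemiring R] {x c : R}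
    (hc : c = 1 + x * c ^ 2) (k : ℕ) :
    c ^ (k + 1) = 1 + x * (c ^ (k + 2) + ∑ r ∈ range k, c ^ (r + 2)) := by
  induction k with
  | zero => simpa using hc
  | succ k ih =>
    calc c ^ (k + 2) = c ^ (k + 1) * c := pow_succ c _
      _ = c ^ (k + 1) * (1 + x * c ^ 2) := by rw [← hc]
      _ = c ^ (k + 1) + x * c ^ (k + 3) := by ring
      _ = 1 + x * (c ^ (k + 3) + ∑ r ∈ range (k + 1), c ^ (r + 2)) := by
        rw [ih, sum_range_succ]; ring

theorem coeff_succ_pow_succ {R : Type*} [CommSemiring R] {c : R⟦X⟧} (hc : c = 1 + X * c ^ 2)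
    (m k : ℕ) :
    coeff (m + 1) (c ^ (k + 1)) =
      coeff m (c ^ (k + 2)) + ∑ r ∈ range k, coeff m (c ^ (r + 2)) := by
  rw [pow_succ_eq_one_add_mul_sum hc]
  simp [coeff_one, coeff_succ_X_mul]

theorem card_avoiders_perm123 (n : ℕ) : #(avoiders n perm123) = catalan n := by
  have hc : catalanSeries = 1 + X * catalanSeries ^ 2 := by
    rw [add_comm, mul_comm, catalanSeries_sq_mul_X_add_one]
  have h := sum_avoiders_eq_of_recurrence (S := ℕ) (g := 0) rfl
    (Φ := fun m k _ => coeff m (catalanSeries ^ (k + 1)))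
    (fun m k _ => coeff_succ_pow_succ hc m k) 0 n
  simpa using h

variable {R : Type*} [CommRing R] {c : R⟦X⟧} {P : ℕ → R⟦X⟧} {g : ℕ → R}

/- Iterating the generating tree, the totals from a node with label `k` are of the form
`X * c ^ (k + 1) * P k`; differencing their recurrence in `k` leaves a Poisson equation for `P`. -/
theorem X_mul_pow_mul_eq_of_poisson (hc : c = 1 + X * c ^ 2) (h0 : P 0 = X * c * P 1)
    (hP : ∀ k, P (k + 1) = (1 - X * c) * P k + X * c * P (k + 2) + C (g (k + 1))) (k : ℕ) :
    X * c ^ (k + 1) * P k =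
      X * (X * c ^ (k + 2) * P (k + 1) +
        ∑ r ∈ range k, (X * c ^ (r + 2) * P (r + 1) + C (g (r + 1)) * c ^ (r + 2))) := by
  induction k with
  | zero =>
    simp only [h0, range_zero, sum_empty]
    ring
  | succ k ih =>
    rw [sum_range_succ]
    linear_combination ih + X * c ^ (k + 2) * hP k + X * c ^ (k + 1) * P k * hc

theorem sum_avoiders_eq_coeff_of_poisson (hc : c = 1 + X * c ^ 2) (h0 : P 0 = X * c * P 1)
    (hP : ∀ k, P (k + 1) = (1 - X * c) * P k + X * c * P (k + 2) + C (g (k + 1)))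
    (hg : g 0 = 0) (n : ℕ) :
    ∑ p ∈ avoiders n perm123, ∑ i, g (rightLarger p i) = coeff n (X * c * P 0) := by
  have hcc : constantCoeff c = 1 := by rw [hc]; simp
  have h := sum_avoiders_eq_of_recurrence hg
    (Φ := fun m k s => coeff m (X * c ^ (k + 1) * P k) + s * coeff m (c ^ (k + 1))) ?_ 0 n
  · simpa [mul_assoc, hcc] using h
  · intro m k s
    simp only [X_mul_pow_mul_eq_of_poisson hc h0 hP k, coeff_succ_X_mul, coeff_succ_pow_succ hc,
      map_add, map_sum, coeff_C_mul, sum_add_distrib, mul_add, add_mul, mul_sum]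
    ring

end CatalanSeries

section GeneratingFunctions

theorem map_ofNat_mul {F A B : Type*} [NonAssocSemiring A] [NonAssocSemiring B] [FunLike F A B]
    [AddMonoidHomClass F A B] (f : F) (m : ℕ) [m.AtLeastTwo] (a : A) :
    f (ofNat(m) * a) = ofNat(m) * f a := by
  rw [← Nat.cast_ofNat, ← nsmul_eq_mul, map_nsmul, nsmul_eq_mul, Nat.cast_ofNat]

/-- The generating function of the Catalan numbers over `ℚ`. -/
noncomputable def catalanGF : ℚ⟦X⟧ := PowerSeries.map (Nat.castRingHom ℚ) catalanSeries

theorem coeff_catalanGF (n : ℕ) : coeff n catalanGF = catalan n := by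
  simp [catalanGF]

theorem catalanGF_eq : catalanGF = 1 + X * catalanGF ^ 2 := by
  have h := congrArg (PowerSeries.map (Nat.castRingHom ℚ)) catalanSeries_sq_mul_X_add_one
  rw [map_add, map_mul, map_pow, map_X, map_one, ← catalanGF] at h
  linear_combination -h

theorem sqrtOneSubFourX_eq : sqrtOneSubFourX = 1 - 2 * (X * catalanGF) := by
  have hsq : sqrtOneSubFourX ^ 2 = (1 - 2 * (X * catalanGF)) ^ 2 := by
    linear_combination sqrtOneSubFourX_sq + 4 * X * catalanGF_eq
  refine (sq_eq_sq_iff_eq_or_eq_neg.1 hsq).resolve_right fun h => ?_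
  have h1 := congrArg constantCoeff h
  norm_num [constantCoeff_sqrtOneSubFourX] at h1

theorem sqrtOneSubFourX_mul_inv : sqrtOneSubFourX * sqrtOneSubFourX⁻¹ = 1 :=
  PowerSeries.mul_inv_cancel _ (by simp [constantCoeff_sqrtOneSubFourX])

/- In the next two proofs `P` is found with undetermined coefficients among the polynomials in `k`
of degree one more than `g`. -/
theorem sum_avoiders_rightLarger (n : ℕ) :
    4 * ∑ p ∈ avoiders n perm123, ∑ i, (rightLarger p i : ℚ) =
      coeff n ((sqrtOneSubFourX⁻¹ - 1) ^ 2) := by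
  have hst := sqrtOneSubFourX_mul_inv
  rw [sqrtOneSubFourX_eq] at hst ⊢
  set t := (1 - 2 * (X * catalanGF))⁻¹
  have h := sum_avoiders_eq_coeff_of_poisson catalanGF_eq (g := fun r => 4 * (r : ℚ))
    (P := fun k => 2 * t * ((k : ℚ⟦X⟧) + 1) * ((k : ℚ⟦X⟧) - 1 + t)) ?_ ?_ (by simp) n
  · simp only [mul_sum, h]
    congr 1
    push_cast
    linear_combination (1 - t) * hst
  · push_cast
    linear_combination 2 * t * hst
  · intro k
    simp only [map_mul, map_natCast, map_ofNat]
    push_cast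
    linear_combination (2 * t + 4 * (k + 1)) * hst

theorem sum_avoiders_rightLarger_sq (n : ℕ) :
    4 * ∑ p ∈ avoiders n perm123, ∑ i, (rightLarger p i : ℚ) ^ 2 =
      coeff n (sqrtOneSubFourX⁻¹ * (sqrtOneSubFourX⁻¹ - 1) ^ 2) := by
  have hst := sqrtOneSubFourX_mul_inv
  rw [sqrtOneSubFourX_eq] at hst ⊢
  set t := (1 - 2 * (X * catalanGF))⁻¹
  have h := sum_avoiders_eq_coeff_of_poisson catalanGF_eq (g := fun r => 12 * (r : ℚ) ^ 2)
    (P := fun k => 4 * t * (k : ℚ⟦X⟧) ^ 3 + 6 * t ^ 2 * (k : ℚ⟦X⟧) ^ 2 +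
      (6 * t ^ 3 - 4 * t) * (k : ℚ⟦X⟧) + 6 * t ^ 3 - 6 * t ^ 2) ?_ ?_ (by simp) n
  · have h3 : X * catalanGF * (6 * t ^ 3 - 6 * t ^ 2) = 3 * (t * (t - 1) ^ 2) := by
      linear_combination 3 * t * (1 - t) * hst
    simp only [Nat.cast_zero, zero_pow, ne_eq, OfNat.ofNat_ne_zero, not_false_eq_true, mul_zero,
      zero_add, h3, map_ofNat_mul, ← mul_sum] at h
    linear_combination h / 3
  · push_cast
    linear_combination 6 * t ^ 2 * hst
  · intro k
    simp only [map_mul, map_pow, map_natCast, map_ofNat]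
    push_cast
    linear_combination (12 * (k + 1) ^ 2 + 12 * t * (k + 1) + 6 * t ^ 2) * hst

/-- The Euler operator `f ↦ X f'`. -/
noncomputable def eulerDerivation (R : Type*) [CommSemiring R] : Derivation R R⟦X⟧ R⟦X⟧ :=
  (X : R⟦X⟧) • d⁄dX R

theorem coeff_eulerDerivation {R : Type*} [CommSemiring R] (f : R⟦X⟧) (n : ℕ) :
    coeff n (eulerDerivation R f) = n * coeff n f := by
  cases n with
  | zero => simp [eulerDerivation]
  | succ n => simp [eulerDerivation, coeff_succ_X_mul, coeff_derivative, mul_comm]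

theorem eulerDerivation_X_mul {R : Type*} [CommSemiring R] (f : R⟦X⟧) :
    eulerDerivation R (X * f) = X * (eulerDerivation R f + f) := by
  rw [Derivation.leibniz, smul_eq_mul, smul_eq_mul, eulerDerivation, Derivation.smul_apply,
    Derivation.smul_apply, derivative_X, smul_eq_mul, smul_eq_mul]
  ring

local notation "θ" => eulerDerivation ℚ

theorem eulerDerivation_sqrtOneSubFourX :
    2 * θ sqrtOneSubFourX = sqrtOneSubFourX - sqrtOneSubFourX⁻¹ := by
  have h : 2 * sqrtOneSubFourX * θ sqrtOneSubFourX = -4 * X := by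
    have hsq := congrArg θ sqrtOneSubFourX_sq
    have hX : θ X = X := by simp [eulerDerivation]
    simp only [Derivation.leibniz_pow, nsmul_eq_mul, smul_eq_mul, map_sub,
      Derivation.map_one_eq_zero, map_ofNat_mul, hX] at hsq
    linear_combination hsq
  linear_combination sqrtOneSubFourX⁻¹ * (h - sqrtOneSubFourX_sq) +
    (sqrtOneSubFourX - 2 * θ sqrtOneSubFourX) * sqrtOneSubFourX_mul_inv

theorem eulerDerivation_sqrtOneSubFourX_inv :
    2 * θ sqrtOneSubFourX⁻¹ = sqrtOneSubFourX⁻¹ ^ 3 - sqrtOneSubFourX⁻¹ := by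
  have h := congrArg θ sqrtOneSubFourX_mul_inv
  simp only [Derivation.leibniz, smul_eq_mul, Derivation.map_one_eq_zero] at h
  linear_combination 2 * sqrtOneSubFourX⁻¹ * h -
    sqrtOneSubFourX⁻¹ ^ 2 * eulerDerivation_sqrtOneSubFourX -
    (2 * θ sqrtOneSubFourX⁻¹ + sqrtOneSubFourX⁻¹) * sqrtOneSubFourX_mul_inv

theorem eulerDerivation_catalanGF :
    16 * (X * (θ (θ (θ catalanGF)) - 3 * θ (θ catalanGF) + 2 * θ catalanGF)) =
      3 * sqrtOneSubFourX⁻¹ ^ 5 - 15 * sqrtOneSubFourX⁻¹ ^ 3 + 45 * sqrtOneSubFourX⁻¹ +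
        15 * sqrtOneSubFourX - 48 := by
  have hs := sqrtOneSubFourX_eq
  have h1 := eulerDerivation_sqrtOneSubFourX
  have ht := eulerDerivation_sqrtOneSubFourX_inv
  generalize sqrtOneSubFourX = s, sqrtOneSubFourX⁻¹ = t at *
  have h2 : 4 * θ (θ s) = s - t ^ 3 := by
    have h := congrArg θ h1
    rw [map_ofNat_mul, map_sub] at h
    linear_combination 2 * h + h1 - ht
  have h3 : 8 * θ (θ (θ s)) = s - t + 3 * t ^ 3 - 3 * t ^ 5 := by
    have h := congrArg θ h2
    rw [map_ofNat_mul, map_sub, Derivation.leibniz_pow, nsmul_eq_mul, smul_eq_mul] at h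
    push_cast at h
    linear_combination 2 * h + h1 - 3 * t ^ 2 * ht
  rw [hs] at h1 h2 h3
  simp only [map_sub, map_add, map_zero, Derivation.map_one_eq_zero,
    map_ofNat_mul, eulerDerivation_X_mul] at h1 h2 h3
  linear_combination -h3 + 12 * h2 - 44 * h1 - 15 * hs

theorem totalPatternCount_perm321_avoiders (n : ℕ) :
    6 * (totalPatternCount perm321 (avoiders n perm123) : ℚ) =
      n * (n - 1) * (n - 2) * catalan n +
        6 * ∑ p ∈ avoiders n perm123, ∑ j, (rightLarger p j : ℚ) ^ 2 -
        6 * (n - 1) * ∑ p ∈ avoiders n perm123, ∑ j, (rightLarger p j : ℚ) := by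
  have hp (p) (hp : p ∈ avoiders n perm123) : 6 * (patternCount perm321 p : ℚ) =
      n * (n - 1) * (n - 2) + 3 * (∑ j, (leftSmaller p j : ℚ) ^ 2 + ∑ j, (rightLarger p j : ℚ) ^ 2)
        - 6 * (n - 1) * ∑ j, (leftSmaller p j : ℚ) := by
    rw [mem_avoiders_perm123] at hp
    rw [hp.patternCount_perm321, mul_sub, hp.sum_mul_apply]
    ring
  rw [totalPatternCount, Nat.cast_sum, mul_sum, sum_congr rfl hp]
  simp only [sum_sub_distrib, sum_add_distrib, ← mul_sum, sum_const, card_avoiders_perm123,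
    sum_avoiders_leftSmaller fun m => (m : ℚ), sum_avoiders_leftSmaller fun m => (m : ℚ) ^ 2,
    nsmul_eq_mul]
  ring

theorem mk_totalPatternCount_perm321 :
    12 * PowerSeries.mk (fun n => (totalPatternCount perm321 (avoiders n perm123) : ℚ)) =
      2 * (θ (θ (θ catalanGF)) - 3 * θ (θ catalanGF) + 2 * θ catalanGF) +
        3 * (sqrtOneSubFourX⁻¹ * (sqrtOneSubFourX⁻¹ - 1) ^ 2) -
        3 * (θ ((sqrtOneSubFourX⁻¹ - 1) ^ 2) - (sqrtOneSubFourX⁻¹ - 1) ^ 2) := by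
  ext n
  simp only [map_add, map_sub, map_ofNat_mul, coeff_eulerDerivation, coeff_catalanGF, coeff_mk,
    ← sum_avoiders_rightLarger, ← sum_avoiders_rightLarger_sq]
  linear_combination 2 * totalPatternCount_perm321_avoiders n

instance charZero_powerSeries {R : Type*} [Semiring R] [CharZero R] : CharZero R⟦X⟧ :=
  charZero_of_injective_ringHom PowerSeries.C_injective

theorem two_X_mul_mk_totalPatternCount_perm321 :
    16 * (2 * X * PowerSeries.mk fun n => (totalPatternCount perm321 (avoiders n perm123) : ℚ)) =
      sqrtOneSubFourX⁻¹ ^ 5 - 2 * sqrtOneSubFourX⁻¹ ^ 4 - sqrtOneSubFourX⁻¹ ^ 3 +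
        2 * sqrtOneSubFourX⁻¹ ^ 2 + 7 * sqrtOneSubFourX⁻¹ - 14 + 9 * sqrtOneSubFourX -
        2 * sqrtOneSubFourX ^ 2 := by
  have hs := sqrtOneSubFourX_sq
  have hst := sqrtOneSubFourX_mul_inv
  have ht := eulerDerivation_sqrtOneSubFourX_inv
  have hc := eulerDerivation_catalanGF
  have h := mk_totalPatternCount_perm321
  generalize sqrtOneSubFourX = s, sqrtOneSubFourX⁻¹ = t at *
  have hθ : θ ((t - 1) ^ 2) = (t - 1) * (t ^ 3 - t) := by
    rw [Derivation.leibniz_pow, nsmul_eq_mul, smul_eq_mul, map_sub, Derivation.map_one_eq_zero]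
    push_cast
    linear_combination (t - 1) * ht
  rw [hθ] at h
  refine mul_left_cancel₀ (OfNat.ofNat_ne_zero 6) ?_
  linear_combination 16 * X * h + 2 * hc - 12 * (t - 1) ^ 3 * (t + 1) * hs +
    (12 * t ^ 2 * (s * t + 1) - 24 * t * (s * t + 1) + 24 * s) * hst

theorem sixteen_mul_numerators_eq {R : Type*} [CommRing R] {x s t : R} (hx : 4 * x = 1 - s ^ 2)
    (hst : s * t = 1) :
    16 * ((8 * x ^ 3 - 20 * x ^ 2 + 8 * x - 1) * t ^ 4 -
        (36 * x ^ 3 - 34 * x ^ 2 + 10 * x - 1) * t ^ 5) =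
      t ^ 5 - 2 * t ^ 4 - t ^ 3 + 2 * t ^ 2 + 7 * t - 14 + 9 * s - 2 * s ^ 2 := by
  have hA : 16 * (8 * x ^ 3 - 20 * x ^ 2 + 8 * x - 1) =
      -2 + 2 * s ^ 2 - 14 * s ^ 4 - 2 * s ^ 6 := by
    calc _ = 2 * (4 * x) ^ 3 - 20 * (4 * x) ^ 2 + 32 * (4 * x) - 16 := by ring
      _ = _ := by rw [hx]; ring
  have hB : 16 * (36 * x ^ 3 - 34 * x ^ 2 + 10 * x - 1) = -1 + s ^ 2 - 7 * s ^ 4 - 9 * s ^ 6 := by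
    calc _ = 9 * (4 * x) ^ 3 - 34 * (4 * x) ^ 2 + 40 * (4 * x) - 16 := by ring
      _ = _ := by rw [hx]; ring
  have pow_t (i j : ℕ) : s ^ i * t ^ (i + j) = t ^ j := by
    rw [pow_add, ← mul_assoc, ← mul_pow, hst, one_pow, one_mul]
  have pow_s (i j : ℕ) : s ^ (i + j) * t ^ i = s ^ j := by
    rw [add_comm, pow_add, mul_assoc, ← mul_pow, hst, one_pow, mul_one]
  linear_combination t ^ 4 * hA - t ^ 5 * hB + 2 * pow_t 2 2 - 14 * pow_t 4 0 - 2 * pow_s 4 2 -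
    pow_t 2 3 + 7 * pow_t 4 1 + 9 * pow_s 5 1

theorem inv_pow_powerSeries {k : Type*} [Field k] (f : k⟦X⟧) (n : ℕ) : (f ^ n)⁻¹ = f⁻¹ ^ n := by
  induction n with
  | zero => simp
  | succ n ih => rw [pow_succ, PowerSeries.mul_inv_rev, ih, pow_succ']

end GeneratingFunctions

theorem mainTheorem5 :
    2 * (PowerSeries.X : PowerSeries ℚ) *
        PowerSeries.mk (fun n : ℕ => (totalPatternCount perm321 (avoiders n perm123) : ℚ)) =
      (8 * PowerSeries.X ^ 3 - 20 * PowerSeries.X ^ 2 + 8 * PowerSeries.X - 1) *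
          ((1 - 4 * PowerSeries.X) ^ 2)⁻¹ -
        (36 * PowerSeries.X ^ 3 - 34 * PowerSeries.X ^ 2 + 10 * PowerSeries.X - 1) *
          (sqrtOneSubFourX ^ 5)⁻¹ := by
  have four_X : 4 * (X : ℚ⟦X⟧) = 1 - sqrtOneSubFourX ^ 2 := by rw [sqrtOneSubFourX_sq]; ring
  refine mul_left_cancel₀ (OfNat.ofNat_ne_zero 16) ?_
  rw [two_X_mul_mk_totalPatternCount_perm321, ← sqrtOneSubFourX_sq, ← pow_mul,
    inv_pow_powerSeries, inv_pow_powerSeries,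
    sixteen_mul_numerators_eq four_X sqrtOneSubFourX_mul_inv]
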